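/- Let $m\ge 1$ and let $F_m$ be the free group with free basis $A$, $|A|=m$. For a group $G$ generated by (the image of) a finite set $S$, let $B(n)$ be the set of elements of $G$ represented by words of length at most $n$ in $S^{\pm1}$, and let $\omega(G,S)=\lim_{n\to\infty}|B(n)|^{1/n}$ be the growth rate. Write $H'=[H,H]$ and $H''=(H')'$. (1) The set of finite-index subgroups of $F_m$ is countable, and it can be enumerated (possibly with repetitions) as $N_1,N_2,\dots$ in such a way that all the subgroups $M_i=N_1\cap\dots\cap N_i$ are normal in $F_m$. (2) Let $N_1,N_2,\dots$ be any sequence of finite-index subgroups of $F_m$ in which every normal finite-index subgroup of $F_m$ occurs (for instance, an enumeration of all finite-index subgroups, or of all normal finite-index subgroups), and let $M_i=N_1\cap\dots\cap N_i$ (with $M_0=F_m$). For every $i$ such that $M_i$ is normal in $F_m$ (this holds for every $i$ if all $N_j$ are normal), the group $F_m/M_i''$ is a finite extension of a free metabelian group: the image $M_i/M_i''$ of $M_i$ is a normal subgroup of finite index in $F_m/M_i''$, and it is a free metabelian group, that is, isomorphic to $F/F''$ for some free group $F$. For these $i$ the growth rates $\omega(F_m/M_i'',A)$ exist and tend to $2m-1$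 as $i\to\infty$; in particular $\lim_{i\to\infty}\omega(F_m/M_i'',A)=2m-1$ if all $M_i$ are normal. (3) Consequently, for every $\varepsilon>0$ there exist an amenable group $G$ that has a metabelian normal subgroup of finite index, and elements $a_1,\dots,a_m$ generating $G$, such that $|\omega(G,\{a_1,\dots,a_m\})-(2m-1)|<\varepsilon$. -/

import Mathlib

open Filter Topology

/-- The ball `B(n)` of radius `n` in the group `G` with respect to `A`: the elements represented
by a word of length at most `n` in the alphabet `A^{±1}`. -/
def wordBall {G : Type*} [Group G] (A : Set G) (n : ℕ) : Set G :=
  {g | ∃ l : List G, l.length ≤ n ∧ (∀ x ∈ l, x ∈ A ∨ x⁻¹ ∈ A) ∧ l.prod = g}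

/-- The growth rate `lim_{n → ∞} |B(n)|^{1/n}` of the pair `(G, A)` exists and equals `w`. -/
def HasGrowthRate {G : Type*} [Group G] (A : Set G) (w : ℝ) : Prop :=
  Tendsto (fun n : ℕ => ((wordBall A n).ncard : ℝ) ^ ((1 : ℝ) / (n : ℝ))) atTop (𝓝 w)

/-- A function `f : G → ℝ` is bounded. -/
def IsBoundedFun {G : Type*} (f : G → ℝ) : Prop := ∃ C : ℝ, ∀ x, |f x| ≤ C

/-- `G`, as a discrete group, is amenable: there is a left-invariant mean on the space of all
bounded real functions on `G`. The values of `μ` at unbounded functions are irrelevant. -/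
def IsAmenableGroup (G : Type*) [Group G] : Prop :=
  ∃ μ : (G → ℝ) → ℝ,
    (∀ f g, IsBoundedFun f → IsBoundedFun g → μ (fun x => f x + g x) = μ f + μ g) ∧
    (∀ (c : ℝ) f, IsBoundedFun f → μ (fun x => c * f x) = c * μ f) ∧
    (∀ f, IsBoundedFun f → (∀ x, 0 ≤ f x) → 0 ≤ μ f) ∧
    μ (fun _ => 1) = 1 ∧
    (∀ (h : G) f, IsBoundedFun f → μ (fun x => f (h * x)) = μ f)

/-- `G` is metabelian: its second derived subgroup is trivial. -/
def IsMetabelian (G : Type*) [Group G] : Prop := derivedSeries G 2 = ⊥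

/-- `G` is a finite extension of a metabelian group. -/
def IsMetabelianByFinite (G : Type*) [Group G] : Prop :=
  ∃ K : Subgroup G, K.Normal ∧ K.FiniteIndex ∧ IsMetabelian K

/-- `G` is a free metabelian group, i.e. isomorphic to `F / F''` for some free group `F`. -/
def IsFreeMetabelian (G : Type*) [Group G] : Prop :=
  ∃ X : Type, Nonempty (G ≃* FreeGroup X ⧸ derivedSeries (FreeGroup X) 2)

/-- The second derived subgroup `M''` of a subgroup `M`, as a subgroup of the ambient group. -/
def secondDerived {G : Type*} [Group G] (M : Subgroup G) : Subgroup G :=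
  ⁅⁅M, M⁆, ⁅M, M⁆⁆

instance secondDerived_normal {G : Type*} [Group G] (M : Subgroup G) [M.Normal] :
    (secondDerived M).Normal := by
  unfold secondDerived; infer_instance

/-- The intersection of the first `i` terms `N 0, …, N (i - 1)` of a sequence of subgroups
(the whole group for `i = 0`). -/
def firstInter {G : Type*} [Group G] (N : ℕ → Subgroup G) (i : ℕ) : Subgroup G :=
  ⨅ j, ⨅ _ : j < i, N j

/-! The upper bound `2m - 1` counts reduced words. For the lower bound put `R = [M, M]`, so that
`M'' = [R, R]`. A word traces a path in the Cayley graph of `F / R`, and its class modulo `[R, R]`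
determines the mod 2 flow of that path. A path that never meets itself can be recovered from its
flow, so self-avoiding words are pairwise distinct in `F / M''` (`SelfAvoiding.eq_of_mk_eq`).

Self-avoiding words are plentiful. Take reduced blocks of a common length `l` and a common exponent
sum `H ≠ 0` that concatenate without cancellation. A piece of a concatenation that lies in `R ≤ [F,
F]` has exponent sum `0`, while the exponent sum grows along the word at the steady rate `H / l`; so
the piece has length at most `4 l²`. If `R` has no nontrivial elements that short, every
concatenation is self-avoiding (`selfAvoiding_flatten`). By pigeonhole there are at least `(2m-1)^L
/ (2m(2L+1))` such blocks with `l ≤ L + 3`, which pushes the growth rate towards `2m - 1`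
(`exists_forall_le_growthRate`).

Residual finiteness gives a normal finite-index `K` without short nontrivial elements. It occurs
among the `N_j`, so `M_i ≤ K` from some point on. The rest is structural: `M_i` is free by
Nielsen–Schreier, and metabelian-by-finite groups are amenable, since finite and abelian groups are
and extensions preserve amenability. -/

section Flow

/-! ### Flows on the Cayley graph of `F / R` and self-avoiding words. -/

variable {α : Type*} (R : Subgroup (FreeGroup α))

open Classical in
/-- The edge leaving `g` labelled by `a` is toggled, and `g` is moved along it. -/
noncomputable def flowStep [R.Normal] (a : α) :
    Equiv.Perm (((FreeGroup α ⧸ R) × α → ZMod 2) × (FreeGroup α ⧸ R)) where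
  toFun p := (p.1 + Pi.single (p.2, a) 1, (QuotientGroup.mk (FreeGroup.of a)) * p.2)
  invFun p := (p.1 + Pi.single ((QuotientGroup.mk (FreeGroup.of a))⁻¹ * p.2, a) 1,
    (QuotientGroup.mk (FreeGroup.of a))⁻¹ * p.2)
  left_inv p := by
    ext1
    · dsimp only
      rw [inv_mul_cancel_left, add_assoc, ← Pi.single_add, CharTwo.add_self_eq_zero,
        Pi.single_zero, add_zero]
    · exact inv_mul_cancel_left _ _
  right_inv p := by
    ext1
    · dsimp only
      rw [add_assoc, ← Pi.single_add, CharTwo.add_self_eq_zero, Pi.single_zero, add_zero]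
    · exact mul_inv_cancel_left _ _

/-- The action of the free group on pairs of a mod `2` flow on the Cayley graph of `F / R` and a
vertex of it. -/
noncomputable def flowHom [R.Normal] : FreeGroup α →*
    Equiv.Perm (((FreeGroup α ⧸ R) × α → ZMod 2) × (FreeGroup α ⧸ R)) :=
  FreeGroup.lift (flowStep R)

variable {R} [R.Normal]

/-- The edges toggled depend on the starting vertex only, not on the flow already present. -/
theorem flowHom_translation (x : FreeGroup α) :
    ∃ c : (FreeGroup α ⧸ R) → ((FreeGroup α ⧸ R) × α → ZMod 2),
      ∀ f g, flowHom R x (f, g) = (f + c g, (x : FreeGroup α ⧸ R) * g) := by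
  classical
  induction x using FreeGroup.induction_on with
  | C1 => exact ⟨0, fun f g => by simp⟩
  | of a => exact ⟨fun g => Pi.single (g, a) 1, fun f g => by simp [flowHom, flowStep]⟩
  | inv_of a _ =>
    refine ⟨fun g => Pi.single ((QuotientGroup.mk (FreeGroup.of a))⁻¹ * g, a) 1, fun f g => ?_⟩
    rw [map_inv, flowHom, FreeGroup.lift_apply_of]
    rfl
  | mul x y hx hy =>
    obtain ⟨c, hc⟩ := hx
    obtain ⟨d, hd⟩ := hy
    refine ⟨fun g => d g + c (y * g), fun f g => ?_⟩
    rw [map_mul, Equiv.Perm.mul_apply, hd, hc, QuotientGroup.mk_mul, mul_assoc, add_assoc]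

/-- Elements of `R` fix every vertex, so over each vertex they act as translations of the flow, and
translations commute. -/
theorem flowHom_eq_one_of_mem_commutator {x : FreeGroup α} (hx : x ∈ ⁅R, R⁆) :
    flowHom R x = 1 := by
  have h : ⁅R, R⁆ ≤ (flowHom R).ker := by
    rw [Subgroup.commutator_le]
    intro r hr s hs
    rw [MonoidHom.mem_ker, map_commutatorElement, commutatorElement_eq_one_iff_mul_comm]
    obtain ⟨c, hc⟩ := flowHom_translation (R := R) r
    obtain ⟨d, hd⟩ := flowHom_translation (R := R) s
    have hr1 : (r : FreeGroup α ⧸ R) = 1 := (QuotientGroup.eq_one_iff r).2 hr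
    have hs1 : (s : FreeGroup α ⧸ R) = 1 := (QuotientGroup.eq_one_iff s).2 hs
    ext1 ⟨f, g⟩
    simp only [Equiv.Perm.mul_apply, hc, hd, hr1, hs1, one_mul]
    rw [add_right_comm]
  exact h hx

/-- The flow and the end point of a word. -/
noncomputable def flow (R : Subgroup (FreeGroup α)) [R.Normal] (w : List (α × Bool)) :
    ((FreeGroup α ⧸ R) × α → ZMod 2) × (FreeGroup α ⧸ R) :=
  flowHom R (FreeGroup.mk w) (0, 1)

/-- The edge along which the letter `x` enters the vertex `v`. -/
def enteringEdge (x : α × Bool) (v : FreeGroup α ⧸ R) : (FreeGroup α ⧸ R) × α :=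
  (if x.2 then (QuotientGroup.mk (FreeGroup.of x.1))⁻¹ * v else v, x.1)

open Classical in
theorem flowHom_letter (x : α × Bool)
    (f : (FreeGroup α ⧸ R) × α → ZMod 2) (g : FreeGroup α ⧸ R) :
    flowHom R (FreeGroup.mk [x]) (f, g) =
      (f + Pi.single (enteringEdge x (QuotientGroup.mk (FreeGroup.mk [x]) * g)) 1,
        QuotientGroup.mk (FreeGroup.mk [x]) * g) := by
  obtain ⟨a, _ | _⟩ := x
  · have h : (FreeGroup.mk [(a, false)]) = (FreeGroup.of a)⁻¹ := rfl
    rw [h, map_inv, flowHom, FreeGroup.lift_apply_of]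
    rfl
  · have h : (FreeGroup.mk [(a, true)]) = FreeGroup.of a := rfl
    rw [h, flowHom, FreeGroup.lift_apply_of]
    simp [flowStep, enteringEdge]

theorem flow_snd (w : List (α × Bool)) : (flow R w).2 = (FreeGroup.mk w : FreeGroup α) := by
  obtain ⟨c, hc⟩ := flowHom_translation (R := R) (FreeGroup.mk w)
  rw [flow, hc, mul_one]

-- The action is on the left, so a word is traversed from its last letter: prefixing `x` is the
-- final step of the path, and the visited vertices are the classes of the suffixes.
open Classical in
theorem flow_cons (x : α × Bool)
    (w : List (α × Bool)) :
    flow R (x :: w) = ((flow R w).1 + Pi.single (enteringEdge x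
      (QuotientGroup.mk (FreeGroup.mk (x :: w)))) 1, QuotientGroup.mk (FreeGroup.mk (x :: w))) := by
  have h : (FreeGroup.mk (x :: w)) = FreeGroup.mk [x] * FreeGroup.mk w := rfl
  have h2 : flow R (x :: w) = flowHom R (FreeGroup.mk [x]) ((flow R w).1, (flow R w).2) := by
    rw [flow, h, map_mul]; rfl
  rw [h2, flowHom_letter, flow_snd, h, QuotientGroup.mk_mul]

/-- An edge with nonzero flow has been traversed, so both its end points have been visited. -/
theorem flow_support (w : List (α × Bool)) (e : (FreeGroup α ⧸ R) × α)
    (he : (flow R w).1 e ≠ 0) :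
    (∃ s, s <:+ w ∧ e.1 = (FreeGroup.mk s : FreeGroup α)) ∧
    (∃ s, s <:+ w ∧ (FreeGroup.of e.2 : FreeGroup α) * e.1 = (FreeGroup.mk s : FreeGroup α)) := by
  classical
  induction w with
  | nil =>
    exfalso
    apply he
    have : FreeGroup.mk ([] : List (α × Bool)) = 1 := rfl
    simp [flow, this]
  | cons x w ih =>
    rw [flow_cons] at he
    by_cases h : e = enteringEdge x (FreeGroup.mk (x :: w) : FreeGroup α)
    · have h1 : ((FreeGroup.mk (x :: w) : FreeGroup α) : FreeGroup α ⧸ R) =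
        (FreeGroup.mk [x] : FreeGroup α) * (FreeGroup.mk w : FreeGroup α) := rfl
      obtain ⟨a, _ | _⟩ := x
      · have h2 : (FreeGroup.mk [(a, false)]) = (FreeGroup.of a)⁻¹ := rfl
        refine ⟨⟨_, List.suffix_refl _, by rw [h]; rfl⟩, w, List.suffix_cons _ _, ?_⟩
        rw [h, h1, h2]
        simp [enteringEdge]
      · have h2 : (FreeGroup.mk [(a, true)]) = FreeGroup.of a := rfl
        refine ⟨⟨w, List.suffix_cons _ _, ?_⟩, _, List.suffix_refl _, ?_⟩
        · rw [h, h1, h2]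
          simp [enteringEdge]
        · rw [h]
          simp [enteringEdge]
    · have : (flow R w).1 e ≠ 0 := by
        simpa [Pi.single_eq_of_ne h] using he
      obtain ⟨⟨s, hs, hs'⟩, t, ht, ht'⟩ := ih this
      exact ⟨⟨s, hs.trans (List.suffix_cons _ _), hs'⟩, t, ht.trans (List.suffix_cons _ _), ht'⟩

/-- No nonempty piece of the word `w` represents an element of `R`: the path of `w` in the Cayley
graph of `F / R` does not meet itself. -/
def SelfAvoiding (R : Subgroup (FreeGroup α)) (w : List (α × Bool)) : Prop :=
  ∀ s, s <:+: w → s ≠ [] → FreeGroup.mk s ∉ R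

omit [R.Normal] in
theorem SelfAvoiding.infix {w v : List (α × Bool)} (h : SelfAvoiding R w) (hv : v <:+: w) :
    SelfAvoiding R v := fun s hs => h s (hs.trans hv)

theorem SelfAvoiding.end_ne {x : α × Bool} {w s : List (α × Bool)} (h : SelfAvoiding R (x :: w))
    (hs : s <:+ w) : ((FreeGroup.mk (x :: w) : FreeGroup α) : FreeGroup α ⧸ R) ≠
      (FreeGroup.mk s : FreeGroup α) := by
  obtain ⟨t, rfl⟩ := hs
  intro h1
  apply h (x :: t) ⟨[], s, by simp⟩ (by simp)
  have h2 : FreeGroup.mk (x :: (t ++ s)) = FreeGroup.mk (x :: t) * FreeGroup.mk s := by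
    rw [FreeGroup.mul_mk]; rfl
  rw [h2, QuotientGroup.mk_mul, mul_eq_right] at h1
  exact (QuotientGroup.eq_one_iff _).1 h1

/-- The final vertex is new, so no edge incident to it was used before the last step. -/
theorem SelfAvoiding.flow_enteringEdge_eq_zero {x y : α × Bool} {w : List (α × Bool)}
    (h : SelfAvoiding R (x :: w)) :
    (flow R w).1 (enteringEdge y (FreeGroup.mk (x :: w) : FreeGroup α)) = 0 := by
  by_contra h0
  obtain ⟨⟨s, hs, hs'⟩, t, ht, ht'⟩ := flow_support _ _ h0
  obtain ⟨a, _ | _⟩ := y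
  · exact h.end_ne hs (by simpa [enteringEdge] using hs')
  · exact h.end_ne ht (by simpa [enteringEdge] using ht')

/-- The edge shows the generator; the sign could be ambiguous only if the edge were a loop. -/
theorem enteringEdge_injective {x y : α × Bool} {v : FreeGroup α ⧸ R}
    (hx : FreeGroup.mk [x] ∉ R) (h : enteringEdge x v = enteringEdge y v) : x = y := by
  obtain ⟨a, i⟩ := x
  obtain ⟨b, j⟩ := y
  simp only [enteringEdge, Prod.mk.injEq] at h
  obtain ⟨h1, rfl⟩ := h
  have hR : FreeGroup.of a ∉ R := by
    cases i
    · have h2 : (FreeGroup.mk [(a, false)]) = (FreeGroup.of a)⁻¹ := rfl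
      rwa [h2, inv_mem_iff] at hx
    · exact hx
  have hR' : ¬ ((FreeGroup.of a : FreeGroup α) : FreeGroup α ⧸ R) = 1 :=
    fun h => hR ((QuotientGroup.eq_one_iff _).1 h)
  cases i <;> cases j <;> simp_all

/-- A self-avoiding word is determined by its flow. -/
theorem SelfAvoiding.eq_of_flow_eq {w w' : List (α × Bool)} (h : SelfAvoiding R w)
    (h' : SelfAvoiding R w') (hf : flow R w = flow R w') : w = w' := by
  classical
  have hnil : ∀ v : List (α × Bool), SelfAvoiding R v → flow R [] = flow R v → [] = v := by
    intro v hv hf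
    by_contra hne
    apply hv v (List.infix_refl _) (Ne.symm hne)
    have := congrArg Prod.snd hf
    rw [flow_snd, flow_snd] at this
    exact (QuotientGroup.eq_one_iff _).1 this.symm
  induction w generalizing w' with
  | nil => exact hnil _ h' hf
  | cons x u ih =>
    cases w' with
    | nil => exact (hnil _ h hf.symm).symm
    | cons y u' =>
      have hend : ((FreeGroup.mk (x :: u) : FreeGroup α) : FreeGroup α ⧸ R) =
          (FreeGroup.mk (y :: u') : FreeGroup α) := by
        have := congrArg Prod.snd hf
        rwa [flow_snd, flow_snd] at this
      -- The last edge of the first path carries flow `1`. If `y ≠ x`, the second path carries `0`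
      -- there, as it uses only one edge at its final vertex.
      have hxy : x = y := by
        by_contra hne
        have hne' : enteringEdge x ((FreeGroup.mk (x :: u) : FreeGroup α) : FreeGroup α ⧸ R) ≠
            enteringEdge y ((FreeGroup.mk (y :: u') : FreeGroup α) : FreeGroup α ⧸ R) := by
          rw [← hend]
          exact fun h1 => hne (enteringEdge_injective (h [x] ⟨[], u, rfl⟩ (by simp)) h1)
        have h1 := congrFun (congrArg Prod.fst hf)
          (enteringEdge x ((FreeGroup.mk (x :: u) : FreeGroup α) : FreeGroup α ⧸ R))
        rw [flow_cons, flow_cons] at h1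
        dsimp only at h1
        rw [Pi.add_apply, Pi.add_apply, h.flow_enteringEdge_eq_zero,
          Pi.single_eq_same, Pi.single_eq_of_ne hne', hend, h'.flow_enteringEdge_eq_zero] at h1
        exact absurd h1 (by decide)
      subst hxy
      congr 1
      apply ih (h.infix (List.suffix_cons _ _).isInfix) (h'.infix (List.suffix_cons _ _).isInfix)
      have h1 : ∀ v : List (α × Bool), flow R (x :: v) = flowHom R (FreeGroup.mk [x]) (flow R v) := by
        intro v
        have : FreeGroup.mk (x :: v) = FreeGroup.mk [x] * FreeGroup.mk v := rfl
        rw [flow, this, map_mul]; rfl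
      rw [h1, h1] at hf
      exact (flowHom R (FreeGroup.mk [x])).injective hf

/-- A self-avoiding word is determined by the element of `F / [R, R]` that it represents. -/
theorem SelfAvoiding.eq_of_mk_eq {w w' : List (α × Bool)} (h : SelfAvoiding R w)
    (h' : SelfAvoiding R w')
    (hw : (FreeGroup.mk w : FreeGroup α ⧸ ⁅R, R⁆) = (FreeGroup.mk w' : FreeGroup α)) :
    w = w' := by
  apply h.eq_of_flow_eq h'
  have h1 := flowHom_eq_one_of_mem_commutator (QuotientGroup.eq.1 hw)
  rw [map_mul, map_inv, inv_mul_eq_one] at h1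
  rw [flow, flow, h1]

end Flow

/-! ### Existence of growth rates and comparison with exponentials. -/

section Growth

theorem wordBall_range {G α : Type*} [Group G] (a : α → G) (n : ℕ) :
    wordBall (Set.range a) n =
      (fun l : List (α × Bool) => FreeGroup.lift a (FreeGroup.mk l)) '' {l | l.length ≤ n} := by
  ext g
  constructor
  · rintro ⟨l, hl, hA, rfl⟩
    suffices h : ∃ l' : List (α × Bool), l'.length = l.length ∧
        FreeGroup.lift a (FreeGroup.mk l') = l.prod by
      obtain ⟨l', h1, h2⟩ := h
      exact ⟨l', h1.trans_le hl, h2⟩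
    clear hl
    induction l with
    | nil => exact ⟨[], rfl, by simp⟩
    | cons x l ih =>
      obtain ⟨l', h1, h2⟩ := ih fun y hy => hA y (List.mem_cons_of_mem _ hy)
      rw [FreeGroup.lift_mk] at h2
      rcases hA x List.mem_cons_self with ⟨b, hb⟩ | ⟨b, hb⟩
      · exact ⟨(b, true) :: l', by simp [h1], by simp [h2, hb]⟩
      · exact ⟨(b, false) :: l', by simp [h1], by simp [h2, hb]⟩
  · rintro ⟨l, hl, rfl⟩
    refine ⟨l.map fun x => cond x.2 (a x.1) (a x.1)⁻¹, by simpa using hl, ?_, by simp⟩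
    intro x hx
    obtain ⟨⟨b, i⟩, -, rfl⟩ := List.mem_map.1 hx
    cases i
    · exact Or.inr ⟨b, by simp⟩
    · exact Or.inl ⟨b, by simp⟩

theorem wordBall_range_finite {G α : Type*} [Group G] [Finite α] (a : α → G) (n : ℕ) :
    (wordBall (Set.range a) n).Finite := by
  rw [wordBall_range]
  exact (List.finite_length_le _ n).image _

theorem one_mem_wordBall {G : Type*} [Group G] (A : Set G) (n : ℕ) : 1 ∈ wordBall A n :=
  ⟨[], by simp, by simp, rfl⟩

theorem wordBall_add_subset {G : Type*} [Group G] (A : Set G) (n k : ℕ) :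
    wordBall A (n + k) ⊆ Set.image2 (· * ·) (wordBall A n) (wordBall A k) := by
  rintro g ⟨l, hl, hA, rfl⟩
  refine ⟨(l.take n).prod, ⟨_, by simp, fun x hx => hA x (List.mem_of_mem_take hx), rfl⟩,
    (l.drop n).prod, ⟨_, by simp; omega, fun x hx => hA x (List.mem_of_mem_drop hx), rfl⟩, ?_⟩
  exact List.prod_take_mul_prod_drop l n

theorem ncard_wordBall_add_le {G : Type*} [Group G] {A : Set G}
    (hA : ∀ n, (wordBall A n).Finite) (n k : ℕ) :
    (wordBall A (n + k)).ncard ≤ (wordBall A n).ncard * (wordBall A k).ncard := by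
  refine (Set.ncard_le_ncard (wordBall_add_subset A n k) ((hA n).image2 _ (hA k))).trans ?_
  rw [← Set.image_prod, ← Set.ncard_prod]
  exact Set.ncard_image_le ((hA n).prod (hA k))

theorem one_le_ncard_wordBall {G : Type*} [Group G] {A : Set G}
    (hA : ∀ n, (wordBall A n).Finite) (n : ℕ) : 1 ≤ (wordBall A n).ncard :=
  (Set.ncard_pos (hA n)).2 ⟨1, one_mem_wordBall A n⟩

/-- The growth rate exists, by Fekete's lemma. -/
theorem exists_hasGrowthRate {G : Type*} [Group G] {A : Set G}
    (hA : ∀ n, (wordBall A n).Finite) : ∃ w, HasGrowthRate A w := by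
  have hpos : ∀ n, (1 : ℝ) ≤ (wordBall A n).ncard := fun n => by
    exact_mod_cast one_le_ncard_wordBall hA n
  set u : ℕ → ℝ := fun n => Real.log (wordBall A n).ncard with hu
  have hsub : Subadditive u := by
    intro n k
    simp only [hu]
    rw [← Real.log_mul (by linarith [hpos n]) (by linarith [hpos k])]
    exact Real.log_le_log (by linarith [hpos (n + k)])
      (by exact_mod_cast ncard_wordBall_add_le hA n k)
  have hbdd : BddBelow (Set.range fun n => u n / n) := by
    refine ⟨0, ?_⟩
    rintro _ ⟨n, rfl⟩
    exact div_nonneg (Real.log_nonneg (hpos n)) n.cast_nonneg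
  refine ⟨Real.exp hsub.lim, ?_⟩
  refine ((Real.continuous_exp.tendsto _).comp (hsub.tendsto_lim hbdd)).congr fun n => ?_
  rw [Real.rpow_def_of_pos (by linarith [hpos n])]
  simp [hu, div_eq_mul_inv]

theorem HasGrowthRate.one_le {G : Type*} [Group G] {A : Set G} {w : ℝ} (h : HasGrowthRate A w)
    (hA : ∀ n, (wordBall A n).Finite) : 1 ≤ w :=
  ge_of_tendsto' h fun n => Real.one_le_rpow
    (by exact_mod_cast one_le_ncard_wordBall hA n) (by positivity)

theorem HasGrowthRate.le_of_pow_le {G : Type*} [Group G] {A : Set G} {w : ℝ}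
    (h : HasGrowthRate A w) {q : ℝ} (hq : 0 ≤ q) {l : ℕ} (hl : 0 < l)
    (hB : ∀ n, q ^ (l * n) ≤ (wordBall A (l * n)).ncard) : q ≤ w := by
  -- The multiples of `l` suffice as radii because the limit exists; `n + 1` avoids the zeroth root.
  have ht : Tendsto (fun n : ℕ => l * (n + 1)) atTop atTop :=
    tendsto_atTop_mono (fun n => by dsimp only [id]; nlinarith) tendsto_id
  refine ge_of_tendsto' (h.comp ht) fun n => ?_
  have hne : l * (n + 1) ≠ 0 := by positivity
  calc q = (q ^ (l * (n + 1))) ^ ((1 : ℝ) / ((l * (n + 1) : ℕ) : ℝ)) := by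
        rw [one_div, Real.pow_rpow_inv_natCast hq hne]
    _ ≤ _ := Real.rpow_le_rpow (by positivity) (hB (n + 1)) (by positivity)

theorem HasGrowthRate.le_of_le_mul_pow {G : Type*} [Group G] {A : Set G} {w : ℝ}
    (h : HasGrowthRate A w) {q C : ℝ} (hq : 0 ≤ q) (hC : 0 < C)
    (hB : ∀ n : ℕ, ((wordBall A n).ncard : ℝ) ≤ (n + 1) * C * q ^ n) : w ≤ q := by
  -- For `n ≥ 1` the factor `(n + 1) * C` is at most `2 * C * n`, whose `n`-th root tends to `1`.
  have h1 : Tendsto (fun n : ℕ => (2 * C) ^ ((1 : ℝ) / n) * (n : ℝ) ^ ((1 : ℝ) / n) * q)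
      atTop (𝓝 q) := by
    have h2 : Tendsto (fun n : ℕ => (2 * C) ^ ((1 : ℝ) / n)) atTop (𝓝 1) := by
      have := (Real.continuousAt_const_rpow (a := 2 * C) (b := 0) (by positivity)).tendsto.comp
        (tendsto_one_div_atTop_nhds_zero_nat (𝕜 := ℝ))
      rwa [Real.rpow_zero] at this
    have h3 := tendsto_rpow_div.comp (tendsto_natCast_atTop_atTop (R := ℝ))
    simpa using (h2.mul h3).mul_const q
  refine le_of_tendsto_of_tendsto h h1 ?_
  filter_upwards [eventually_ge_atTop 1] with n hn
  have hn' : (1 : ℝ) ≤ n := by exact_mod_cast hn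
  have hq' : q = (q ^ n) ^ ((1 : ℝ) / n) := by
    rw [one_div, Real.pow_rpow_inv_natCast hq (by omega)]
  rw [← Real.mul_rpow (by positivity) (by positivity)]
  nth_rw 1 [hq']
  rw [← Real.mul_rpow (by positivity) (by positivity)]
  refine Real.rpow_le_rpow (by positivity) ((hB n).trans ?_) (by positivity)
  gcongr ?_ * _
  nlinarith

end Growth

/-! ### Counting reduced words: the upper bound. -/

section ReducedWords

variable {α : Type*} [Fintype α]

open Classical in
/-- The words of length `n` that give a reduced word when they follow the letter `x`. -/
noncomputable def continuations : α × Bool → ℕ → Finset (List (α × Bool))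
  | _, 0 => {[]}
  | x, n + 1 => (Finset.univ.filter fun y : α × Bool => x.1 = y.1 → x.2 = y.2).biUnion
      fun y => (continuations y n).image (List.cons y)

theorem mem_continuations {x : α × Bool} {n : ℕ} {l : List (α × Bool)} :
    l ∈ continuations x n ↔ l.length = n ∧ FreeGroup.IsReduced (x :: l) := by
  classical
  induction n generalizing x l with
  | zero =>
    simp only [continuations, Finset.mem_singleton, List.length_eq_zero_iff]
    exact ⟨fun h => ⟨h, h ▸ FreeGroup.IsReduced.singleton⟩, fun h => h.1⟩
  | succ n ih =>
    cases l with
    | nil => simp [continuations]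
    | cons y l =>
      simp only [continuations, Finset.mem_biUnion, Finset.mem_filter, Finset.mem_univ, true_and,
        Finset.mem_image, ih, List.cons.injEq, FreeGroup.isReduced_cons_cons, List.length_cons,
        Nat.add_right_cancel_iff]
      constructor
      · rintro ⟨z, h1, l', ⟨h2, h3⟩, rfl, rfl⟩
        exact ⟨h2, h1, h3⟩
      · rintro ⟨h1, h2, h3⟩
        exact ⟨y, h2, l, ⟨h1, h3⟩, rfl, rfl⟩

/-- After any letter, every letter except its inverse is allowed. -/
theorem card_continuations (x : α × Bool) (n : ℕ) :
    (continuations x n).card = (2 * Fintype.card α - 1) ^ n := by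
  classical
  induction n generalizing x with
  | zero => simp [continuations]
  | succ n ih =>
    rw [continuations, Finset.card_biUnion]
    · have h : (Finset.univ.filter fun y : α × Bool => x.1 = y.1 → x.2 = y.2) =
          Finset.univ.erase (x.1, !x.2) := by
        ext ⟨b, i⟩
        obtain ⟨a, j⟩ := x
        simp only [Finset.mem_filter, Finset.mem_univ, true_and, Finset.mem_erase, ne_eq,
          Prod.mk.injEq, and_true]
        cases i <;> cases j <;> simp [eq_comm]
      have h2 : ∀ y : α × Bool, ((continuations y n).image (List.cons y)).card =
          (2 * Fintype.card α - 1) ^ n := fun y => by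
        rw [Finset.card_image_of_injective _ (List.cons_injective), ih]
      simp only [h2, Finset.sum_const, smul_eq_mul, h]
      rw [Finset.card_erase_of_mem (Finset.mem_univ _), Finset.card_univ, Fintype.card_prod,
        Fintype.card_bool, pow_succ, mul_comm, mul_comm 2]
    · intro y _ z _ hyz
      rw [Function.onFun, Finset.disjoint_left]
      rintro l hl hl'
      obtain ⟨l1, -, rfl⟩ := Finset.mem_image.1 hl
      obtain ⟨l2, -, h⟩ := Finset.mem_image.1 hl'
      exact hyz (List.cons.inj h).1.symm

/-- Reduction does not lengthen words, and a nonempty reduced word may follow a copy of its own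
first letter. The sum over that letter costs the factor `2 * card α`. -/
theorem ncard_wordBall_range_le [Nonempty α] {G : Type*} [Group G] (a : α → G) (n : ℕ) :
    (wordBall (Set.range a) n).ncard ≤
      (n + 1) * (2 * Fintype.card α) * (2 * Fintype.card α - 1) ^ n := by
  classical
  set T : Finset (List (α × Bool)) := (Finset.range (n + 1)).biUnion fun j =>
    Finset.univ.biUnion fun x => continuations x j with hT
  have hsub : wordBall (Set.range a) n ⊆
      ((T.image fun l => FreeGroup.lift a (FreeGroup.mk l) : Finset G) : Set G) := by
    rw [wordBall_range]
    rintro _ ⟨l, hl, rfl⟩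
    simp only [Finset.coe_image]
    refine ⟨FreeGroup.reduce l, ?_, by dsimp only; rw [FreeGroup.reduce.self]⟩
    have hred : FreeGroup.IsReduced (FreeGroup.reduce l) :=
      FreeGroup.isReduced_iff_reduce_eq.2 FreeGroup.reduce.idem
    have hlen : (FreeGroup.reduce l).length ≤ l.length := FreeGroup.norm_mk_le
    have hl' : l.length ≤ n := hl
    simp only [hT, Finset.coe_biUnion, Set.mem_iUnion, Finset.mem_coe]
    refine ⟨_, Finset.mem_range.2 (by omega : (FreeGroup.reduce l).length < n + 1), ?_⟩
    cases h : FreeGroup.reduce l with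
    | nil => exact ⟨(Classical.arbitrary α, true), Finset.mem_univ _,
        mem_continuations.2 ⟨rfl, FreeGroup.IsReduced.singleton⟩⟩
    | cons x r =>
      refine ⟨x, Finset.mem_univ _, mem_continuations.2 ⟨rfl, ?_⟩⟩
      rw [h] at hred
      exact FreeGroup.isReduced_cons_cons.2 ⟨fun _ => rfl, hred⟩
  calc (wordBall (Set.range a) n).ncard
      ≤ (T.image fun l => FreeGroup.lift a (FreeGroup.mk l)).card := by
        rw [← Set.ncard_coe_finset]
        exact Set.ncard_le_ncard hsub (Finset.finite_toSet _)
    _ ≤ T.card := Finset.card_image_le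
    _ ≤ ∑ j ∈ Finset.range (n + 1), ∑ _x : α × Bool, (2 * Fintype.card α - 1) ^ n := by
        refine Finset.card_biUnion_le.trans (Finset.sum_le_sum fun j hj => ?_)
        refine Finset.card_biUnion_le.trans (Finset.sum_le_sum fun x _ => ?_)
        rw [card_continuations]
        have : 0 < Fintype.card α := Fintype.card_pos
        exact Nat.pow_le_pow_right (by omega) (by simpa [Nat.lt_succ_iff] using hj)
    _ = _ := by
        simp only [Finset.sum_const, Finset.card_range, Finset.card_univ, Fintype.card_prod,
          Fintype.card_bool, smul_eq_mul]
        ring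

theorem HasGrowthRate.le_two_mul_card_sub_one [Nonempty α] {G : Type*} [Group G] {a : α → G}
    {w : ℝ} (h : HasGrowthRate (Set.range a) w) : w ≤ 2 * Fintype.card α - 1 := by
  have hc : 1 ≤ Fintype.card α := Fintype.card_pos
  have hc' : (1 : ℝ) ≤ Fintype.card α := by exact_mod_cast hc
  refine h.le_of_le_mul_pow (C := 2 * Fintype.card α) (by linarith) (by linarith) fun n => ?_
  have := ncard_wordBall_range_le a n
  have h2 : ((2 * Fintype.card α - 1 : ℕ) : ℝ) = 2 * Fintype.card α - 1 := by
    rw [Nat.cast_sub (by omega)]; simp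
  rw [← h2]
  exact_mod_cast this

end ReducedWords

/-! ### Blocks with constant drift: the lower bound. -/

section Blocks

variable {α : Type*}

/-- The sum of the exponents of a word. -/
def expSum (l : List (α × Bool)) : ℤ := (l.map fun x => cond x.2 (1 : ℤ) (-1)).sum

@[simp] theorem expSum_nil : expSum ([] : List (α × Bool)) = 0 := rfl

@[simp] theorem expSum_cons (x : α × Bool) (l : List (α × Bool)) :
    expSum (x :: l) = cond x.2 (1 : ℤ) (-1) + expSum l := by simp [expSum]

@[simp] theorem expSum_append (l l' : List (α × Bool)) :
    expSum (l ++ l') = expSum l + expSum l' := by simp [expSum]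

theorem abs_expSum_le (l : List (α × Bool)) : |expSum l| ≤ l.length := by
  induction l with
  | nil => simp
  | cons x l ih =>
    have : |cond x.2 (1 : ℤ) (-1)| = 1 := by cases x.2 <;> simp
    rw [expSum_cons]
    refine (abs_add_le _ _).trans ?_
    rw [this, List.length_cons]
    push_cast
    linarith

theorem expSum_eq_zero_of_mem_commutator {l : List (α × Bool)}
    (h : FreeGroup.mk l ∈ commutator (FreeGroup α)) : expSum l = 0 := by
  have h1 : ∀ l : List (α × Bool),
      FreeGroup.lift (fun _ : α => Multiplicative.ofAdd (1 : ℤ)) (FreeGroup.mk l) =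
        Multiplicative.ofAdd (expSum l) := by
    intro l
    rw [FreeGroup.lift_mk]
    induction l with
    | nil => rfl
    | cons x l ih =>
      rw [List.map_cons, List.prod_cons, ih, expSum_cons, ofAdd_add]
      cases x.2 <;> rfl
  have h2 := Abelianization.commutator_subset_ker
    (FreeGroup.lift (fun _ : α => Multiplicative.ofAdd (1 : ℤ))) h
  rw [MonoidHom.mem_ker, h1] at h2
  exact h2

/-- Words of a fixed length and a fixed nonzero exponent sum, which can be concatenated freely
without cancellation. -/
structure IsBlock (a : α × Bool) (l : ℕ) (H : ℤ) (u : List (α × Bool)) : Prop where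
  length_eq : u.length = l
  expSum_eq : expSum u = H
  head_eq : ∃ t, u = a :: t
  isReduced : FreeGroup.IsReduced (u ++ [a])

variable {a : α × Bool} {l : ℕ} {H : ℤ}

theorem isReduced_flatten {W : List (List (α × Bool))} (hW : ∀ u ∈ W, IsBlock a l H u) :
    FreeGroup.IsReduced W.flatten := by
  -- The first letter is carried along because a block is only known to be followed safely by `a`.
  suffices h : FreeGroup.IsReduced W.flatten ∧ (W.flatten = [] ∨ ∃ t, W.flatten = a :: t) from h.1
  induction W with
  | nil => exact ⟨FreeGroup.IsReduced.nil, Or.inl rfl⟩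
  | cons u W ih =>
    have hu := hW u List.mem_cons_self
    obtain ⟨h1, h2⟩ := ih fun v hv => hW v (List.mem_cons_of_mem _ hv)
    obtain ⟨t, ht⟩ := hu.head_eq
    rw [List.flatten_cons]
    refine ⟨?_, Or.inr ⟨t ++ W.flatten, by rw [ht]; rfl⟩⟩
    rcases h2 with h2 | ⟨s, hs⟩
    · rw [h2, List.append_nil]
      exact hu.isReduced.infix ⟨[], [a], by simp⟩
    · have h3 := FreeGroup.IsReduced.append_overlap (L₁ := u) (L₂ := [a]) (L₃ := s) hu.isReduced
        (by rw [List.singleton_append, ← hs]; exact h1) (by simp)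
      rwa [hs, ← List.singleton_append, ← List.append_assoc]

theorem abs_drift_le (hH : |H| ≤ l) (s : List (α × Bool)) :
    |l * expSum s - H * s.length| ≤ 2 * l * s.length := by
  have h1 := abs_expSum_le s
  rw [abs_le] at *
  have : (0 : ℤ) ≤ s.length := by positivity
  have : (0 : ℤ) ≤ l := by positivity
  constructor <;> nlinarith

/-- The quantity `l * expSum - H * length` vanishes on complete blocks, so only the last, incomplete
block contributes: at most `l` letters, each at most `2 * l`. -/
theorem abs_drift_prefix_le (hH : |H| ≤ l) {W : List (List (α × Bool))}
    (hW : ∀ u ∈ W, IsBlock a l H u) {p : List (α × Bool)} (hp : p <+: W.flatten) :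
    |l * expSum p - H * p.length| ≤ 2 * l * l := by
  induction W generalizing p with
  | nil =>
    rw [List.flatten_nil, List.prefix_nil] at hp
    subst hp
    simp
    positivity
  | cons u W ih =>
    have hu := hW u List.mem_cons_self
    rw [List.flatten_cons] at hp
    rcases List.prefix_or_prefix_of_prefix hp (List.prefix_append u W.flatten) with h | ⟨t, rfl⟩
    · refine (abs_drift_le hH p).trans ?_
      have := h.length_le
      rw [hu.length_eq] at this
      gcongr
    · have ht := ih (fun v hv => hW v (List.mem_cons_of_mem _ hv))
        ((List.prefix_append_right_inj u).1 hp)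
      rw [expSum_append, List.length_append, hu.expSum_eq, hu.length_eq]
      push_cast
      convert ht using 2
      ring

theorem selfAvoiding_flatten (hH0 : H ≠ 0) (hH : |H| ≤ l) {W : List (List (α × Bool))}
    (hW : ∀ u ∈ W, IsBlock a l H u) {R : Subgroup (FreeGroup α)}
    (hR : R ≤ commutator (FreeGroup α))
    (hshort : ∀ s : List (α × Bool), s.length ≤ 4 * l * l → FreeGroup.mk s ∈ R →
      FreeGroup.mk s = 1) :
    SelfAvoiding R W.flatten := by
  classical
  intro s hs hne hsR
  have hred := (isReduced_flatten hW).infix hs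
  have h0 := expSum_eq_zero_of_mem_commutator (hR hsR)
  have hlen : s.length ≤ 4 * l * l := by
    obtain ⟨p, t, hpt⟩ := hs
    have h1 := abs_drift_prefix_le hH hW ⟨s ++ t, by rw [← List.append_assoc]; exact hpt⟩
    have h2 := abs_drift_prefix_le hH hW ⟨t, hpt⟩
    rw [expSum_append, h0, List.length_append] at h2
    push_cast at h2
    -- The drift of `s` is the difference of the drifts of two prefixes, and it equals `-H *
    -- s.length` as the exponent sum is zero.
    have h3 : |H * s.length| ≤ 4 * l * l := by
      rw [abs_le] at *
      constructor <;> nlinarith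
    rw [abs_mul, Nat.abs_cast] at h3
    have h4 : (1 : ℤ) ≤ |H| := Int.one_le_abs hH0
    have h5 : (s.length : ℤ) ≤ 4 * l * l := by nlinarith
    exact_mod_cast h5
  have h1 := hshort s hlen hsR
  rw [← FreeGroup.toWord_eq_nil_iff, FreeGroup.toWord_mk, hred.reduce_eq] at h1
  exact hne h1

theorem card_pow_le_ncard_wordBall [Finite α] (hH0 : H ≠ 0) (hH : |H| ≤ l)
    {U : Finset (List (α × Bool))} (hU : ∀ u ∈ U, IsBlock a l H u) {R : Subgroup (FreeGroup α)}
    [R.Normal] (hR : R ≤ commutator (FreeGroup α))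
    (hshort : ∀ s : List (α × Bool), s.length ≤ 4 * l * l → FreeGroup.mk s ∈ R →
      FreeGroup.mk s = 1) (n : ℕ) :
    U.card ^ n ≤ (wordBall (Set.range fun a : α =>
      QuotientGroup.mk' ⁅R, R⁆ (FreeGroup.of a)) (l * n)).ncard := by
  have hlift : FreeGroup.lift (fun a : α => QuotientGroup.mk' ⁅R, R⁆ (FreeGroup.of a)) =
      QuotientGroup.mk' ⁅R, R⁆ := by
    ext a
    simp
  set word : (Fin n → U) → List (List (α × Bool)) :=
    fun f => List.ofFn fun i => (f i : List (α × Bool)) with hword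
  have hmem : ∀ f, ∀ u ∈ word f, IsBlock a l H u := by
    intro f u hu
    obtain ⟨i, rfl⟩ := List.mem_ofFn.1 hu
    exact hU _ (f i).2
  have hmap : ∀ f, (word f).map List.length = List.replicate n l := by
    intro f
    rw [List.eq_replicate_iff]
    refine ⟨by simp [hword], fun k hk => ?_⟩
    obtain ⟨u, hu, rfl⟩ := List.mem_map.1 hk
    exact (hmem f u hu).length_eq
  set F : (Fin n → U) → FreeGroup α ⧸ ⁅R, R⁆ := fun f => FreeGroup.mk (word f).flatten with hF
  have hinj : Function.Injective F := by
    intro f g hfg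
    have h1 := (selfAvoiding_flatten hH0 hH (hmem f) hR hshort).eq_of_mk_eq
      (selfAvoiding_flatten hH0 hH (hmem g) hR hshort) hfg
    -- All blocks have length `l`, so the concatenation can be cut back into its blocks.
    have h2 : word f = word g := List.eq_iff_flatten_eq.2 ⟨h1, by rw [hmap, hmap]⟩
    funext i
    exact Subtype.ext (congrFun (List.ofFn_injective h2) i)
  have hcard : (Set.range F).ncard = U.card ^ n := by
    rw [← Set.image_univ, Set.ncard_image_of_injective _ hinj, Set.ncard_univ]
    simp
  rw [← hcard]
  refine Set.ncard_le_ncard ?_ (wordBall_range_finite _ _)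
  rintro _ ⟨f, rfl⟩
  rw [wordBall_range]
  refine ⟨(word f).flatten, ?_, by rw [hlift]; rfl⟩
  rw [Set.mem_ofPred_eq, List.length_flatten, hmap, List.sum_replicate, smul_eq_mul, mul_comm]

theorem exists_blocks [Fintype α] (hα : 2 ≤ Fintype.card α) (L : ℕ) :
    ∃ (U : Finset (List (α × Bool))) (a : α × Bool) (l : ℕ) (H : ℤ),
      0 < l ∧ l ≤ L + 3 ∧ H ≠ 0 ∧ |H| ≤ l ∧ (∀ u ∈ U, IsBlock a l H u) ∧
      (2 * Fintype.card α - 1) ^ L ≤ U.card * (2 * Fintype.card α * (2 * L + 1)) := by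
  classical
  obtain ⟨i, j, hij⟩ := Fintype.exists_pair_of_one_lt_card hα
  set a : α × Bool := (i, true) with ha
  -- Pigeonhole on the last letter and the exponent sum; including `a` gives a last letter even when
  -- `L = 0`.
  set f : List (α × Bool) → (α × Bool) × ℤ :=
    fun u => ((a :: u).getLast (by simp), expSum u) with hf
  set T : Finset ((α × Bool) × ℤ) := Finset.univ ×ˢ Finset.Icc (-(L : ℤ)) L with hT
  have hmaps : ∀ u ∈ continuations a L, f u ∈ T := by
    intro u hu
    have h1 := abs_expSum_le u
    rw [(mem_continuations.1 hu).1, abs_le] at h1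
    simpa [hT, hf] using h1
  have hTcard : T.card = 2 * Fintype.card α * (2 * L + 1) := by
    rw [hT, Finset.card_product, Finset.card_univ, Fintype.card_prod, Fintype.card_bool,
      Int.card_Icc]
    have : ((L : ℤ) + 1 - -L).toNat = 2 * L + 1 := by omega
    rw [this, mul_comm (Fintype.card α)]
  have hTne : T.Nonempty := ⟨(a, 0), by simp [hT]⟩
  obtain ⟨⟨z, h⟩, -, hmax⟩ := Finset.exists_max_image T
    (fun y => ((continuations a L).filter fun u => f u = y).card) hTne
  set V := (continuations a L).filter fun u => f u = (z, h) with hV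
  have hcard : (2 * Fintype.card α - 1) ^ L ≤ V.card * T.card := by
    rw [← card_continuations a L]
    exact Finset.card_le_mul_card_image_of_maps_to hmaps _ hmax
  -- A positive letter cancels neither against `z` nor against the `a` that opens the next block;
  -- the second generator `j` is needed when `z` is the inverse of `a`.
  set y : α × Bool := if z = (i, false) then (j, true) else (i, true) with hy
  have hy2 : y.2 = true := by rw [hy]; split_ifs <;> rfl
  have hzy : z.1 = y.1 → z.2 = y.2 := by
    intro h1
    rw [hy2]
    rw [hy] at h1
    split_ifs at h1 with h2
    · rw [h2] at h1
      exact absurd h1 hij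
    · by_contra h3
      exact h2 (Prod.ext h1 (by simpa using h3))
  -- One or two copies of `y` are appended, whichever makes the exponent sum nonzero.
  obtain ⟨k, hk0, hk2, hk⟩ : ∃ k : ℕ, 0 < k ∧ k ≤ 2 ∧ 1 + h + k ≠ 0 := by
    by_cases h1 : 1 + h + 1 = 0
    · exact ⟨2, by omega, le_rfl, by push_cast; omega⟩
    · exact ⟨1, by omega, by omega, by push_cast; omega⟩
  have hrep : expSum (List.replicate k y) = k := by
    simp [expSum, hy2]
  have hblock : ∀ u ∈ V, IsBlock a (L + 1 + k) (1 + h + k) (a :: (u ++ List.replicate k y)) := by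
    intro u hu
    obtain ⟨hu1, hu2⟩ := Finset.mem_filter.1 hu
    obtain ⟨hlen, hred⟩ := mem_continuations.1 hu1
    have hlast : (a :: u).getLast (by simp) = z := congrArg Prod.fst hu2
    have hexp : expSum u = h := congrArg Prod.snd hu2
    refine ⟨by simp [hlen]; omega, by simp [hexp, hrep, ha]; ring, ⟨_, rfl⟩, ?_⟩
    have hassoc : a :: (u ++ List.replicate k y) ++ [a] =
      (a :: u) ++ (List.replicate k y ++ [a]) := by simp
    rw [hassoc, FreeGroup.IsReduced, List.isChain_append]
    refine ⟨hred, ?_, ?_⟩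
    · rw [List.isChain_append]
      refine ⟨List.isChain_replicate_of_rel _ fun _ => rfl, List.isChain_singleton _, ?_⟩
      intro p hp q hq _
      obtain rfl := List.eq_of_mem_replicate (List.mem_of_mem_getLast? hp)
      simp only [List.head?_cons, Option.mem_def, Option.some.injEq] at hq
      rw [← hq, hy2]
    · intro p hp q hq
      rw [List.getLast?_eq_getLast_of_ne_nil (by simp), hlast, Option.mem_def,
        Option.some.injEq] at hp
      obtain ⟨k', rfl⟩ := Nat.exists_eq_succ_of_ne_zero hk0.ne'
      rw [List.replicate_succ, List.cons_append, List.head?_cons, Option.mem_def,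
        Option.some.injEq] at hq
      rw [← hp, ← hq]
      exact hzy
  have hinj : Function.Injective fun u : List (α × Bool) => a :: (u ++ List.replicate k y) :=
    fun u v huv => List.append_left_injective _ (List.cons.inj huv).2
  have hVpos : V.Nonempty := by
    by_contra hne
    rw [Finset.not_nonempty_iff_eq_empty.1 hne, Finset.card_empty, zero_mul] at hcard
    have : 0 < (2 * Fintype.card α - 1) ^ L := pow_pos (by omega) _
    omega
  refine ⟨V.image fun u => a :: (u ++ List.replicate k y), a, L + 1 + k, 1 + h + k, by omega,
    by omega, hk, ?_, ?_, ?_⟩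
  · obtain ⟨u, hu⟩ := hVpos
    have h1 := abs_expSum_le (a :: (u ++ List.replicate k y))
    rwa [(hblock u hu).length_eq, (hblock u hu).expSum_eq] at h1
  · intro v hv
    obtain ⟨u, hu, rfl⟩ := Finset.mem_image.1 hv
    exact hblock u hu
  · rw [Finset.card_image_of_injective _ hinj, ← hTcard]
    exact hcard

theorem exists_pow_mul_le_pow {q c A : ℝ} (hq : 0 < q) (hqc : q < c) :
    ∃ L : ℕ, q ^ (L + 3) * (A * (2 * L + 1)) ≤ c ^ L := by
  have hc : 0 < c := hq.trans hqc
  have hr0 : 0 ≤ q / c := by positivity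
  have hr1 : q / c < 1 := (div_lt_one hc).2 hqc
  have h1 := tendsto_self_mul_const_pow_of_lt_one hr0 hr1
  have h2 := tendsto_pow_atTop_nhds_zero_of_lt_one hr0 hr1
  have h3 := ((h1.const_mul 2).add h2).const_mul (q ^ 3 * A)
  rw [mul_zero, add_zero, mul_zero] at h3
  obtain ⟨L, hL⟩ := (h3.eventually (gt_mem_nhds one_pos)).exists
  refine ⟨L, ?_⟩
  have h4 : q ^ L = (q / c) ^ L * c ^ L := by rw [div_pow]; field_simp
  have h5 : q ^ (L + 3) * (A * (2 * L + 1)) =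
      (q ^ 3 * A * (2 * (L * (q / c) ^ L) + (q / c) ^ L)) * c ^ L := by
    rw [pow_add, h4]; ring
  rw [h5]
  exact mul_le_of_le_one_left (by positivity) hL.le

/-- The growth rate of `F / [R, R]` is close to the growth rate of `F` if the subgroup `R` of the
commutator subgroup contains no short elements. -/
theorem exists_forall_le_growthRate [Fintype α] (hα : 2 ≤ Fintype.card α) {q : ℝ} (hq1 : 1 ≤ q)
    (hq : q < 2 * Fintype.card α - 1) :
    ∃ K : ℕ, ∀ (R : Subgroup (FreeGroup α)) [R.Normal], R ≤ commutator (FreeGroup α) →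
      (∀ s : List (α × Bool), s.length ≤ K → FreeGroup.mk s ∈ R → FreeGroup.mk s = 1) →
      ∀ w, HasGrowthRate (Set.range fun a : α => QuotientGroup.mk' ⁅R, R⁆ (FreeGroup.of a)) w →
        q ≤ w := by
  -- `L` is so large that the loss in the pigeonhole and the three extra letters still leave `q ^ l`
  -- blocks.
  obtain ⟨L, hL⟩ := exists_pow_mul_le_pow (A := 2 * Fintype.card α) (by linarith) hq
  obtain ⟨U, a, l, H, hl0, hl, hH0, hH, hU, hcard⟩ := exists_blocks hα L
  have hUq : q ^ l ≤ U.card := by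
    have h1 : ((2 * Fintype.card α - 1 : ℕ) : ℝ) = 2 * Fintype.card α - 1 := by
      rw [Nat.cast_sub (by omega)]; simp
    have h2 : (2 * (Fintype.card α : ℝ) - 1) ^ L ≤
        U.card * (2 * Fintype.card α * (2 * L + 1)) := by
      rw [← h1]
      exact_mod_cast hcard
    have h3 : (0 : ℝ) < 2 * Fintype.card α * (2 * L + 1) := by
      have : (0 : ℝ) < Fintype.card α := by exact_mod_cast (by omega : 0 < Fintype.card α)
      positivity
    exact (pow_le_pow_right₀ hq1 hl).trans (le_of_mul_le_mul_right (hL.trans h2) h3)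
  refine ⟨4 * l * l, fun R _ hR hshort w hw => hw.le_of_pow_le (by linarith) hl0 fun n => ?_⟩
  rw [pow_mul]
  calc (q ^ l) ^ n ≤ (U.card : ℝ) ^ n := by gcongr
    _ ≤ _ := by exact_mod_cast card_pow_le_ncard_wordBall hH0 hH hU hR hshort n

end Blocks

/-! ### Residual finiteness of free groups. -/

section ResiduallyFinite

variable {α : Type*} [DecidableEq α]

/-- Free groups are residually finite: left multiplication by a generator is a partial permutation
of a ball, which extends to a permutation. -/
theorem exists_normal_finiteIndex_of_short [Finite α] (K : ℕ) :
    ∃ N : Subgroup (FreeGroup α), N.Normal ∧ N.FiniteIndex ∧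
      ∀ s : List (α × Bool), s.length ≤ K → FreeGroup.mk s ∈ N → FreeGroup.mk s = 1 := by
  classical
  let V := {g : FreeGroup α // g.norm ≤ K}
  have hfin : Finite V := by
    have := (List.finite_length_le (α × Bool) K).to_subtype
    refine Finite.of_injective
      (fun g : V => (⟨g.1.toWord, g.2⟩ : {l : List (α × Bool) | l.length ≤ K})) fun g h hgh => ?_
    exact Subtype.ext (FreeGroup.toWord_injective (congrArg Subtype.val hgh))
  let e (a : α) : {v : V // (FreeGroup.of a * v.1).norm ≤ K} ≃
      {v : V // ((FreeGroup.of a)⁻¹ * v.1).norm ≤ K} :=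
    { toFun := fun v => ⟨⟨FreeGroup.of a * v.1.1, v.2⟩, by
        rw [inv_mul_cancel_left]; exact v.1.2⟩
      invFun := fun v => ⟨⟨(FreeGroup.of a)⁻¹ * v.1.1, v.2⟩, by
        rw [mul_inv_cancel_left]; exact v.1.2⟩
      left_inv := fun v => by ext1; ext1; exact inv_mul_cancel_left _ _
      right_inv := fun v => by ext1; ext1; exact mul_inv_cancel_left _ _ }
  let σ : FreeGroup α →* Equiv.Perm V := FreeGroup.lift fun a => (e a).extendSubtype
  have hσ : ∀ (a : α) (v : V) (h : (FreeGroup.of a * v.1).norm ≤ K),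
      σ (FreeGroup.of a) v = ⟨FreeGroup.of a * v.1, h⟩ := by
    intro a v h
    simp only [σ, FreeGroup.lift_apply_of]
    exact (e a).extendSubtype_apply_of_mem v h
  have hσ' : ∀ (a : α) (v : V) (h : ((FreeGroup.of a)⁻¹ * v.1).norm ≤ K),
      σ (FreeGroup.of a)⁻¹ v = ⟨(FreeGroup.of a)⁻¹ * v.1, h⟩ := by
    intro a v h
    rw [map_inv, Equiv.Perm.inv_eq_iff_eq, hσ]
    · exact Subtype.ext (mul_inv_cancel_left _ _).symm
    · rw [mul_inv_cancel_left]; exact v.2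
  -- All suffixes of `s` stay in the ball, so the permutations follow true left multiplication, and
  -- the image of `1` reveals the element.
  have hword : ∀ (s : List (α × Bool)) (h : s.length ≤ K),
      σ (FreeGroup.mk s) ⟨1, by simp⟩ = ⟨FreeGroup.mk s, FreeGroup.norm_mk_le.trans h⟩ := by
    intro s
    induction s with
    | nil =>
      intro h
      have : FreeGroup.mk ([] : List (α × Bool)) = 1 := rfl
      simp [this]
    | cons x t ih =>
      intro h
      have h1 : FreeGroup.mk (x :: t) = FreeGroup.mk [x] * FreeGroup.mk t := rfl
      have h2 := ih ((Nat.le_succ _).trans h)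
      have h3 : (FreeGroup.mk [x] * FreeGroup.mk t).norm ≤ K := FreeGroup.norm_mk_le.trans h
      simp only [h1, map_mul, Equiv.Perm.mul_apply, h2]
      obtain ⟨a, _ | _⟩ := x
      · exact hσ' a ⟨FreeGroup.mk t, _⟩ h3
      · exact hσ a ⟨FreeGroup.mk t, _⟩ h3
  refine ⟨σ.ker, inferInstance, inferInstance, fun s hs hmem => ?_⟩
  have h1 := hword s hs
  rw [MonoidHom.mem_ker.1 hmem] at h1
  exact (congrArg Subtype.val h1).symm

end ResiduallyFinite

/-! ### Amenability of metabelian-by-finite groups. -/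

section Amenable

theorem IsBoundedFun.add {G : Type*} {f g : G → ℝ} (hf : IsBoundedFun f) (hg : IsBoundedFun g) :
    IsBoundedFun fun x => f x + g x := by
  obtain ⟨C, hC⟩ := hf
  obtain ⟨D, hD⟩ := hg
  exact ⟨C + D, fun x => (abs_add_le _ _).trans (add_le_add (hC x) (hD x))⟩

theorem IsBoundedFun.const_mul {G : Type*} {f : G → ℝ} (hf : IsBoundedFun f) (c : ℝ) :
    IsBoundedFun fun x => c * f x := by
  obtain ⟨C, hC⟩ := hf
  exact ⟨|c| * C, fun x => by rw [abs_mul]; exact mul_le_mul_of_nonneg_left (hC x) (abs_nonneg c)⟩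

theorem IsBoundedFun.comp {G H : Type*} {f : G → ℝ} (hf : IsBoundedFun f) (φ : H → G) :
    IsBoundedFun fun x => f (φ x) := hf.imp fun _ h x => h (φ x)

theorem isBoundedFun_const {G : Type*} (c : ℝ) : IsBoundedFun fun _ : G => c :=
  ⟨|c|, fun _ => le_rfl⟩

theorem isAmenableGroup_of_finite (G : Type*) [Group G] [Finite G] : IsAmenableGroup G := by
  have := Fintype.ofFinite G
  have hc : (0 : ℝ) < Fintype.card G := by exact_mod_cast Fintype.card_pos
  refine ⟨fun f => (∑ x, f x) / Fintype.card G, ?_, ?_, ?_, ?_, ?_⟩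
  · intro f g _ _
    dsimp only
    rw [Finset.sum_add_distrib, add_div]
  · intro c f _
    dsimp only
    rw [← Finset.mul_sum, mul_div_assoc]
  · intro f _ h
    exact div_nonneg (Finset.sum_nonneg fun x _ => h x) hc.le
  · simp [hc.ne']
  · intro h f _
    dsimp only
    rw [Equiv.sum_comp (Equiv.mulLeft h) f |>.symm]
    rfl

theorem abs_mean_le {G : Type*} {μ : (G → ℝ) → ℝ}
    (hadd : ∀ f g, IsBoundedFun f → IsBoundedFun g → μ (fun x => f x + g x) = μ f + μ g)
    (hmul : ∀ (c : ℝ) f, IsBoundedFun f → μ (fun x => c * f x) = c * μ f)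
    (hpos : ∀ f, IsBoundedFun f → (∀ x, 0 ≤ f x) → 0 ≤ μ f)
    (hone : μ (fun _ => 1) = 1) {f : G → ℝ} {C : ℝ} (hC : ∀ x, |f x| ≤ C) : |μ f| ≤ C := by
  have hf : IsBoundedFun f := ⟨C, hC⟩
  have hcst : ∀ c : ℝ, μ (fun _ => c) = c := fun c => by
    have := hmul c (fun _ => 1) (isBoundedFun_const 1)
    rwa [hone, mul_one] at this
  have h1 := hpos _ ((isBoundedFun_const C).add hf) fun x => by linarith [abs_le.1 (hC x)]
  have h2 := hpos _ ((isBoundedFun_const C).add (hf.const_mul (-1))) fun x => by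
    linarith [abs_le.1 (hC x)]
  rw [hadd _ _ (isBoundedFun_const C) hf, hcst] at h1
  rw [hadd _ _ (isBoundedFun_const C) (hf.const_mul (-1)), hcst, hmul _ _ hf] at h2
  rw [abs_le]
  constructor <;> linarith

/-- An extension of an amenable group by an amenable group is amenable. -/
theorem isAmenableGroup_of_extension {G : Type*} [Group G] (N : Subgroup G) [N.Normal]
    (hN : IsAmenableGroup N) (hQ : IsAmenableGroup (G ⧸ N)) : IsAmenableGroup G := by
  obtain ⟨μ, hadd, hmul, hpos, hone, hinv⟩ := hN
  obtain ⟨ν, kadd, kmul, kpos, kone, kinv⟩ := hQ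
  set F : (G → ℝ) → G ⧸ N → ℝ := fun f q => μ fun n => f (q.out * n) with hF
  have hFb : ∀ f, IsBoundedFun f → IsBoundedFun (F f) := by
    rintro f ⟨C, hC⟩
    exact ⟨C, fun q => abs_mean_le hadd hmul hpos hone fun n => hC _⟩
  -- Invariance of `μ` makes the average over a coset independent of the representative.
  have hout : ∀ f, IsBoundedFun f → ∀ g : G, F f g = μ fun n => f (g * n) := by
    intro f hf g
    obtain ⟨n₀, hn₀⟩ := QuotientGroup.mk_out_eq_mul N g
    simp only [hF, hn₀]
    have := hinv n₀ (fun n => f (g * n)) (hf.comp _)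
    rw [← this]
    simp only [Subgroup.coe_mul, mul_assoc]
  refine ⟨fun f => ν (F f), ?_, ?_, ?_, ?_, ?_⟩
  · intro f g hf hg
    rw [← kadd _ _ (hFb f hf) (hFb g hg)]
    refine congrArg ν (funext fun q => ?_)
    exact hadd _ _ (hf.comp _) (hg.comp _)
  · intro c f hf
    rw [← kmul _ _ (hFb f hf)]
    refine congrArg ν (funext fun q => ?_)
    exact hmul _ _ (hf.comp _)
  · intro f hf h
    exact kpos _ (hFb f hf) fun q => hpos _ (hf.comp _) fun n => h _
  · exact (congrArg ν (funext fun _ => hone)).trans kone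
  · intro h f hf
    dsimp only
    rw [← kinv h _ (hFb f hf)]
    refine congrArg ν (funext fun q => ?_)
    induction q using QuotientGroup.induction_on with
    | H g =>
      rw [hout _ (hf.comp _), ← QuotientGroup.mk_mul, hout _ hf]
      simp only [mul_assoc]

/-- `c` is an upper bound for some average of translates of `f`. -/
def IsAverageBound {G : Type*} [Group G] (f : G → ℝ) (c : ℝ) : Prop :=
  ∃ (n : ℕ) (g : Fin n → G), 0 < n ∧ ∀ x, ∑ i, f (g i * x) ≤ c * n

theorem isAverageBound_of_fintype {G : Type*} [Group G] {f : G → ℝ} {c : ℝ} {ι : Type*}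
    [Fintype ι] [Nonempty ι] (g : ι → G) (h : ∀ x, ∑ i, f (g i * x) ≤ c * Fintype.card ι) :
    IsAverageBound f c := by
  refine ⟨Fintype.card ι, g ∘ (Fintype.equivFin ι).symm, Fintype.card_pos, fun x => ?_⟩
  rw [← (Fintype.equivFin ι).sum_comp]
  simpa using h x

theorem isAverageBound_of_le {G : Type*} [Group G] {f : G → ℝ} {c : ℝ} (h : ∀ x, f x ≤ c) :
    IsAverageBound f c :=
  isAverageBound_of_fintype (ι := Unit) (fun _ => 1) fun x => by simpa using h x

theorem IsAverageBound.ge {G : Type*} [Group G] {f : G → ℝ} {c C : ℝ} (h : IsAverageBound f c)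
    (hC : ∀ x, C ≤ f x) : C ≤ c := by
  obtain ⟨n, g, hn, hg⟩ := h
  have h1 : ∑ _i : Fin n, C ≤ ∑ i, f (g i * 1) := Finset.sum_le_sum fun i _ => hC _
  rw [Finset.sum_const, Finset.card_univ, Fintype.card_fin, nsmul_eq_mul, mul_comm] at h1
  exact le_of_mul_le_mul_right (h1.trans (hg 1)) (by exact_mod_cast hn)

/-- Averaging over all products of the two families serves both functions; commutativity lets either
factor be applied first. -/
theorem IsAverageBound.add {G : Type*} [Group G] (hG : ∀ a b : G, a * b = b * a) {f g : G → ℝ}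
    {c d : ℝ} (hf : IsAverageBound f c) (hg : IsAverageBound g d) :
    IsAverageBound (fun x => f x + g x) (c + d) := by
  obtain ⟨n, s, hn, hs⟩ := hf
  obtain ⟨k, t, hk, ht⟩ := hg
  have : Nonempty (Fin n × Fin k) := ⟨⟨0, hn⟩, ⟨0, hk⟩⟩
  refine isAverageBound_of_fintype (fun p : Fin n × Fin k => s p.1 * t p.2) fun x => ?_
  rw [Finset.sum_add_distrib, Fintype.card_prod, Fintype.card_fin, Fintype.card_fin]
  have h1 : ∑ p : Fin n × Fin k, f (s p.1 * t p.2 * x) ≤ k * (c * n) := by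
    rw [Fintype.sum_prod_type_right]
    calc _ ≤ ∑ _j : Fin k, c * n := Finset.sum_le_sum fun j _ => by
          simpa only [mul_assoc] using hs (t j * x)
      _ = _ := by simp
  have h2 : ∑ p : Fin n × Fin k, g (s p.1 * t p.2 * x) ≤ n * (d * k) := by
    rw [Fintype.sum_prod_type]
    calc _ ≤ ∑ _j : Fin n, d * k := Finset.sum_le_sum fun j _ => by
          simpa only [mul_assoc, hG (s j)] using ht (x * s j)
      _ = _ := by simp
  push_cast
  linarith

theorem IsAverageBound.const_mul {G : Type*} [Group G] {f : G → ℝ} {c a : ℝ} (ha : 0 ≤ a)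
    (h : IsAverageBound f c) : IsAverageBound (fun x => a * f x) (a * c) := by
  obtain ⟨n, g, hn, hg⟩ := h
  refine ⟨n, g, hn, fun x => ?_⟩
  rw [← Finset.mul_sum, mul_assoc]
  exact mul_le_mul_of_nonneg_left (hg x) ha

/-- Averaging over powers of `h` telescopes. Letting `n` grow forces an invariant mean. -/
theorem isAverageBound_translate_sub {G : Type*} [Group G] {f : G → ℝ} {C : ℝ}
    (hC : ∀ x, |f x| ≤ C) (h : G) (n : ℕ) :
    IsAverageBound (fun x => f (h * x) - f x) (2 * C / (n + 1 : ℕ)) := by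
  refine ⟨n + 1, fun i => h ^ (i : ℕ), n.succ_pos, fun x => ?_⟩
  rw [div_mul_cancel₀ _ (by positivity), Fin.sum_univ_eq_sum_range
    (fun i => f (h * (h ^ i * x)) - f (h ^ i * x)) (n + 1)]
  have h1 := Finset.sum_range_sub (fun i => f (h ^ i * x)) (n + 1)
  simp only [pow_succ', mul_assoc] at h1
  rw [h1]
  linarith [abs_le.1 (hC (h * (h ^ n * x))), abs_le.1 (hC (h ^ 0 * x))]

/-- The bounded functions. -/
def boundedFun (G : Type*) : Submodule ℝ (G → ℝ) where
  carrier := {f | IsBoundedFun f}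
  add_mem' hf hg := hf.add hg
  zero_mem' := isBoundedFun_const 0
  smul_mem' c _ hf := hf.const_mul c

/-- Abelian groups are amenable, by the Hahn-Banach theorem. -/
theorem isAmenableGroup_of_comm {G : Type*} [Group G] (hG : ∀ a b : G, a * b = b * a) :
    IsAmenableGroup G := by
  -- This `p` is sublinear; a linear functional below it, extending zero on the zero subspace, is
  -- the mean.
  set p : boundedFun G → ℝ := fun f => sInf {c | IsAverageBound (f : G → ℝ) c} with hp
  have hne : ∀ f : boundedFun G, {c | IsAverageBound (f : G → ℝ) c}.Nonempty := by
    rintro ⟨f, C, hC⟩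
    exact ⟨C, isAverageBound_of_le fun x => (abs_le.1 (hC x)).2⟩
  have hbdd : ∀ f : boundedFun G, BddBelow {c | IsAverageBound (f : G → ℝ) c} := by
    rintro ⟨f, C, hC⟩
    exact ⟨-C, fun c hc => IsAverageBound.ge hc fun x => (abs_le.1 (hC x)).1⟩
  have hple : ∀ (f : boundedFun G) (c : ℝ), IsAverageBound (f : G → ℝ) c → p f ≤ c :=
    fun f c hc => csInf_le (hbdd f) hc
  have hmul' : ∀ a : ℝ, 0 < a → ∀ f, p (a • f) ≤ a * p f := by
    intro a ha f
    rw [← div_le_iff₀' ha]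
    refine le_csInf (hne f) fun c hc => ?_
    rw [div_le_iff₀' ha]
    exact hple _ _ (IsAverageBound.const_mul ha.le hc)
  have hmul : ∀ a : ℝ, 0 < a → ∀ f, p (a • f) = a * p f := by
    intro a ha f
    refine le_antisymm (hmul' a ha f) ?_
    have h1 := hmul' a⁻¹ (inv_pos.2 ha) (a • f)
    rw [inv_smul_smul₀ ha.ne', inv_mul_eq_div, le_div_iff₀' ha] at h1
    exact h1
  have hadd : ∀ f g, p (f + g) ≤ p f + p g := by
    intro f g
    rw [← sub_le_iff_le_add]
    refine le_csInf (hne f) fun c hc => ?_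
    rw [sub_le_comm]
    refine le_csInf (hne g) fun d hd => ?_
    rw [sub_le_iff_le_add']
    exact hple _ _ (IsAverageBound.add hG hc hd)
  obtain ⟨φ, -, hφ⟩ := exists_extension_of_le_sublinear (⟨⊥, 0⟩ : boundedFun G →ₗ.[ℝ] ℝ) p hmul hadd
    (by
      rintro ⟨x, hx⟩
      obtain rfl := (Submodule.mem_bot ℝ).1 hx
      exact le_csInf (hne 0) fun c hc => IsAverageBound.ge hc fun x => le_rfl)
  have hφle : ∀ (f : boundedFun G) (c : ℝ), IsAverageBound (f : G → ℝ) c → φ f ≤ c :=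
    fun f c hc => (hφ f).trans (hple f c hc)
  classical
  set μ : (G → ℝ) → ℝ := fun f => if hf : IsBoundedFun f then φ ⟨f, hf⟩ else 0 with hμ
  have hμφ : ∀ f (hf : IsBoundedFun f), μ f = φ ⟨f, hf⟩ := fun f hf => dif_pos hf
  have hμle : ∀ f c, IsBoundedFun f → IsAverageBound f c → μ f ≤ c := fun f c hf hc => by
    rw [hμφ f hf]; exact hφle _ _ hc
  have mulμ : ∀ (c : ℝ) f, IsBoundedFun f → μ (fun x => c * f x) = c * μ f := by
    intro c f hf
    rw [hμφ f hf, hμφ _ (hf.const_mul c), ← smul_eq_mul, ← map_smul]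
    rfl
  have addμ : ∀ f g, IsBoundedFun f → IsBoundedFun g →
      μ (fun x => f x + g x) = μ f + μ g := by
    intro f g hf hg
    rw [hμφ f hf, hμφ g hg, hμφ _ (hf.add hg), ← map_add]
    rfl
  have hsub : ∀ f, IsBoundedFun f → ∀ h, μ (fun x => f (h * x)) ≤ μ f := by
    intro f hf h
    obtain ⟨C, hC⟩ := id hf
    have hb : IsBoundedFun fun x => f (h * x) + -1 * f x := (hf.comp _).add (hf.const_mul _)
    have h1 : ∀ n : ℕ, μ (fun x => f (h * x) + -1 * f x) ≤ 2 * C / (n + 1 : ℕ) := by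
      intro n
      refine hμle _ _ hb ?_
      simpa only [neg_one_mul, ← sub_eq_add_neg] using isAverageBound_translate_sub hC h n
    have h2 : Tendsto (fun n : ℕ => 2 * C / (n + 1 : ℕ)) atTop (𝓝 0) :=
      (tendsto_const_div_atTop_nhds_zero_nat (2 * C)).comp (tendsto_add_atTop_nat 1)
    have h3 := ge_of_tendsto' h2 h1
    rw [addμ _ _ (hf.comp _) (hf.const_mul _), mulμ _ _ hf] at h3
    linarith
  refine ⟨μ, addμ, mulμ, ?_, ?_, ?_⟩
  · intro f hf h
    have h1 := hμle _ 0 (hf.const_mul (-1)) (isAverageBound_of_le fun x => by linarith [h x])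
    rw [mulμ _ _ hf] at h1
    linarith
  · have h1 := hμle (fun _ : G => 1) 1 (isBoundedFun_const 1) (isAverageBound_of_le fun x => le_rfl)
    have h2 := hμle (fun _ : G => -1 * 1) (-1) (isBoundedFun_const _)
      (isAverageBound_of_le fun x => by simp)
    rw [mulμ _ _ (isBoundedFun_const 1)] at h2
    linarith
  · intro h f hf
    refine le_antisymm (hsub f hf h) ?_
    have h1 := hsub (fun x => f (h * x)) (hf.comp _) h⁻¹
    simpa only [mul_inv_cancel_left] using h1

open scoped commutatorElement in
theorem IsMetabelian.isAmenableGroup {G : Type*} [Group G] (hG : IsMetabelian G) :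
    IsAmenableGroup G := by
  refine isAmenableGroup_of_extension (commutator G) (isAmenableGroup_of_comm ?_)
    (isAmenableGroup_of_comm ?_)
  · rintro ⟨a, ha⟩ ⟨b, hb⟩
    have h1 : ⁅commutator G, commutator G⁆ = ⊥ := by
      rw [← hG, derivedSeries_succ, derivedSeries_one]
    have h2 : ⁅a, b⁆ ∈ (⊥ : Subgroup G) := h1 ▸ Subgroup.commutator_mem_commutator ha hb
    exact Subtype.ext (commutatorElement_eq_one_iff_mul_comm.1 (Subgroup.mem_bot.1 h2))
  · exact fun a b => mul_comm (G := Abelianization G) a b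

theorem IsMetabelianByFinite.isAmenableGroup {G : Type*} [Group G] (hG : IsMetabelianByFinite G) :
    IsAmenableGroup G := by
  obtain ⟨K, hK, hfin, hmet⟩ := hG
  exact isAmenableGroup_of_extension K hmet.isAmenableGroup (isAmenableGroup_of_finite _)

end Amenable

/-! ### Enumerating finite-index subgroups. -/

section FirstInter

variable {G : Type*} [Group G]

theorem mem_firstInter {N : ℕ → Subgroup G} {i : ℕ} {x : G} :
    x ∈ firstInter N i ↔ ∀ j < i, x ∈ N j := by
  simp [firstInter, Subgroup.mem_iInf]

theorem firstInter_le {N : ℕ → Subgroup G} {i j : ℕ} (h : j < i) : firstInter N i ≤ N j :=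
  fun _ hx => mem_firstInter.1 hx j h

theorem firstInter_succ (N : ℕ → Subgroup G) (i : ℕ) :
    firstInter N (i + 1) = firstInter N i ⊓ N i := by
  ext x
  simp only [Subgroup.mem_inf, mem_firstInter, Nat.lt_succ_iff_lt_or_eq]
  exact ⟨fun h => ⟨fun j hj => h j (Or.inl hj), h i (Or.inr rfl)⟩,
    fun h j hj => hj.elim (h.1 j) fun e => e ▸ h.2⟩

theorem firstInter_zero (N : ℕ → Subgroup G) : firstInter N 0 = ⊤ := by simp [firstInter]

theorem firstInter_finiteIndex {N : ℕ → Subgroup G} (hN : ∀ i, (N i).FiniteIndex) (i : ℕ) :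
    (firstInter N i).FiniteIndex := by
  induction i with
  | zero => rw [firstInter_zero]; infer_instance
  | succ i ih => rw [firstInter_succ]; have := hN i; infer_instance

/-- Finite-index subgroups of a finitely generated group are finitely generated, and there are
countably many finite subsets. -/
theorem countable_finiteIndex_subgroups [Countable G] [Group.FG G] :
    {H : Subgroup G | H.FiniteIndex}.Countable := by
  refine (Set.countable_range fun S : Finset G => Subgroup.closure (S : Set G)).mono ?_
  intro H hH
  have : H.FiniteIndex := hH
  obtain ⟨S, hS⟩ := (Group.fg_iff_subgroup_fg H).1 inferInstance
  exact ⟨S, hS⟩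

/-- The finite-index subgroups can be listed so that the first terms have normal intersections:
each subgroup is preceded by its normal core. -/
theorem exists_enumeration_finiteIndex [Countable G] [Group.FG G] :
    ∃ N : ℕ → Subgroup G, Set.range N = {H : Subgroup G | H.FiniteIndex} ∧
      ∀ i, (firstInter N i).Normal := by
  obtain ⟨e, he⟩ := (countable_finiteIndex_subgroups (G := G)).exists_eq_range
    ⟨⊤, (inferInstance : (⊤ : Subgroup G).FiniteIndex)⟩
  have hfin : ∀ k, (e k).FiniteIndex := fun k => by
    have : e k ∈ {H : Subgroup G | H.FiniteIndex} := he ▸ Set.mem_range_self k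
    exact this
  set N : ℕ → Subgroup G := fun i => if Even i then (e (i / 2)).normalCore else e (i / 2) with hN
  have heven : ∀ k, N (2 * k) = (e k).normalCore := fun k => by simp [hN]
  have hodd : ∀ k, N (2 * k + 1) = e k := fun k => by
    have h1 : ¬ Even (2 * k + 1) := by simp
    have h2 : (2 * k + 1) / 2 = k := by omega
    simp [hN, h2]
  refine ⟨N, ?_, ?_⟩
  · ext H
    constructor
    · rintro ⟨i, rfl⟩
      have := hfin (i / 2)
      change (N i).FiniteIndex
      simp only [hN]
      split_ifs <;> infer_instance
    · intro hH
      rw [he] at hH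
      obtain ⟨k, rfl⟩ := hH
      exact ⟨2 * k + 1, hodd k⟩
  · have h2 : ∀ k, (firstInter N (2 * k)).Normal := by
      intro k
      induction k with
      | zero => rw [mul_zero, firstInter_zero]; infer_instance
      | succ k ih =>
        -- Intersecting with `e k` right after its core changes nothing.
        have : firstInter N (2 * (k + 1)) = firstInter N (2 * k) ⊓ (e k).normalCore := by
          rw [mul_add, mul_one, firstInter_succ, firstInter_succ, heven, hodd, inf_assoc,
            inf_eq_left.2 (Subgroup.normalCore_le (e k))]
        rw [this]
        infer_instance
    intro i
    obtain ⟨k, rfl | rfl⟩ := Nat.even_or_odd' i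
    · exact h2 k
    · have := h2 k
      rw [firstInter_succ, heven]
      infer_instance

end FirstInter

/-! ### The image of `M` in `G / M''`. -/

section SecondDerived

variable {G : Type*} [Group G] (M : Subgroup G) [M.Normal]

omit [M.Normal] in
theorem map_subtype_derivedSeries_two :
    (derivedSeries M 2).map M.subtype = secondDerived M := by
  rw [derivedSeries_succ, derivedSeries_one, commutator_def, Subgroup.map_commutator,
    Subgroup.map_commutator, ← MonoidHom.range_eq_map, Subgroup.range_subtype, secondDerived]

theorem ker_subgroupMap_secondDerived :
    ((QuotientGroup.mk' (secondDerived M)).subgroupMap M).ker = derivedSeries M 2 := by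
  ext x
  rw [MonoidHom.mem_ker, ← Subgroup.mem_map_iff_mem (Subgroup.subtype_injective M),
    map_subtype_derivedSeries_two, ← QuotientGroup.eq_one_iff, Subtype.ext_iff]
  rfl

theorem isMetabelian_map_secondDerived :
    IsMetabelian (M.map (QuotientGroup.mk' (secondDerived M))) := by
  rw [IsMetabelian, ← map_derivedSeries_eq
    ((QuotientGroup.mk' (secondDerived M)).subgroupMap_surjective M),
    ← ker_subgroupMap_secondDerived, Subgroup.map_eq_bot_iff]

/-- `M` is free by Nielsen–Schreier, and its image is `M / M''`. -/
theorem isFreeMetabelian_map_secondDerived {G : Type} [Group G] [IsFreeGroup G] (M : Subgroup G)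
    [M.Normal] : IsFreeMetabelian (M.map (QuotientGroup.mk' (secondDerived M))) := by
  refine ⟨IsFreeGroup.Generators M, ⟨?_⟩⟩
  refine (QuotientGroup.quotientKerEquivOfSurjective _
    ((QuotientGroup.mk' (secondDerived M)).subgroupMap_surjective M)).symm.trans
    (QuotientGroup.congr _ _ (IsFreeGroup.toFreeGroup M) ?_)
  rw [ker_subgroupMap_secondDerived]
  exact map_derivedSeries_eq (IsFreeGroup.toFreeGroup M).surjective 2

theorem map_mk_normal : (M.map (QuotientGroup.mk' (secondDerived M))).Normal :=
  Subgroup.Normal.map inferInstance _ (QuotientGroup.mk'_surjective _)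

theorem map_mk_finiteIndex [M.FiniteIndex] :
    (M.map (QuotientGroup.mk' (secondDerived M))).FiniteIndex :=
  ⟨fun h => Subgroup.FiniteIndex.index_ne_zero (H := M) (Nat.eq_zero_of_zero_dvd
    (h ▸ M.index_map_dvd (QuotientGroup.mk'_surjective (secondDerived M))))⟩

theorem isMetabelianByFinite_quotient [M.FiniteIndex] :
    IsMetabelianByFinite (G ⧸ secondDerived M) :=
  ⟨_, map_mk_normal M, map_mk_finiteIndex M, isMetabelian_map_secondDerived M⟩

end SecondDerived

/-! ### Convergence of the growth rates. -/

section GrowthRates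

theorem exists_hasGrowthRate_secondDerived {m : ℕ} (M : Subgroup (FreeGroup (Fin m))) [M.Normal] :
    ∃ w, HasGrowthRate (Set.range fun a : Fin m =>
      QuotientGroup.mk' (secondDerived M) (FreeGroup.of a)) w :=
  exists_hasGrowthRate (wordBall_range_finite _)

theorem exists_forall_le_growthRate_secondDerived {m : ℕ} (hm : 1 ≤ m) {q : ℝ}
    (hq : q < 2 * m - 1) :
    ∃ K : Subgroup (FreeGroup (Fin m)), K.Normal ∧ K.FiniteIndex ∧
      ∀ (M : Subgroup (FreeGroup (Fin m))) [M.Normal], M ≤ K → ∀ w,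
        HasGrowthRate (Set.range fun a : Fin m =>
          QuotientGroup.mk' (secondDerived M) (FreeGroup.of a)) w → q ≤ w := by
  -- Growth rates are at least `1`, which settles this case; it is the only one when `m = 1`.
  by_cases hq1 : q < 1
  · exact ⟨⊤, inferInstance, inferInstance, fun M _ _ w hw =>
      hq1.le.trans (hw.one_le (wordBall_range_finite _))⟩
  · rw [not_lt] at hq1
    have hm2 : 2 ≤ m := by
      by_contra h
      have : m = 1 := by omega
      subst this
      norm_num at hq
      linarith
    obtain ⟨k, hk⟩ := exists_forall_le_growthRate (α := Fin m) (by simpa using hm2) hq1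
      (by simpa using hq)
    obtain ⟨K, hK1, hK2, hK3⟩ := exists_normal_finiteIndex_of_short (α := Fin m) k
    refine ⟨K, hK1, hK2, fun M _ hMK w hw => hk ⁅M, M⁆ ?_ ?_ w hw⟩
    · exact Subgroup.commutator_mono le_top le_top
    · exact fun s hs hmem => hK3 s hs (hMK (Subgroup.commutator_le_left M M hmem))

theorem exists_growthRates_tendsto {m : ℕ} (hm : 1 ≤ m) {N : ℕ → Subgroup (FreeGroup (Fin m))}
    (hN : ∀ H : Subgroup (FreeGroup (Fin m)), H.Normal → H.FiniteIndex → ∃ i, N i = H) :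
    ∃ w : ℕ → ℝ,
      (∀ (i : ℕ) [(firstInter N i).Normal],
        HasGrowthRate
          (Set.range fun a : Fin m =>
            QuotientGroup.mk' (secondDerived (firstInter N i)) (FreeGroup.of a))
          (w i)) ∧
      Tendsto w atTop (𝓝 (2 * (m : ℝ) - 1)) := by
  classical
  have : Nonempty (Fin m) := ⟨⟨0, hm⟩⟩
  -- At indices with a non-normal intersection `w` takes the limit value, so convergence concerns
  -- the normal ones alone.
  set w : ℕ → ℝ := fun i => if h : (firstInter N i).Normal then
    (exists_hasGrowthRate_secondDerived (firstInter N i)).choose else 2 * (m : ℝ) - 1 with hw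
  have hw1 : ∀ (i : ℕ) [(firstInter N i).Normal], HasGrowthRate (Set.range fun a : Fin m =>
      QuotientGroup.mk' (secondDerived (firstInter N i)) (FreeGroup.of a)) (w i) := by
    intro i hi
    simp only [hw, dif_pos hi]
    exact (exists_hasGrowthRate_secondDerived (firstInter N i)).choose_spec
  have hw2 : ∀ i, ¬ (firstInter N i).Normal → w i = 2 * (m : ℝ) - 1 := fun i hi => dif_neg hi
  refine ⟨w, hw1, tendsto_order.2 ⟨fun q hq => ?_, fun q hq => Eventually.of_forall fun i => ?_⟩⟩
  · obtain ⟨r, hqr, hr⟩ := exists_between hq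
    obtain ⟨K, hK1, hK2, hK⟩ := exists_forall_le_growthRate_secondDerived hm hr
    obtain ⟨j, hj⟩ := hN K hK1 hK2
    filter_upwards [eventually_gt_atTop j] with i hi
    by_cases h : (firstInter N i).Normal
    · exact hqr.trans_le (hK _ (hj ▸ firstInter_le hi) _ (hw1 i))
    · rwa [hw2 i h]
  · by_cases h : (firstInter N i).Normal
    · refine lt_of_le_of_lt ?_ hq
      simpa using (hw1 i).le_two_mul_card_sub_one
    · rwa [hw2 i h]

end GrowthRates

theorem mainTheorem4 (m : ℕ) (hm : 1 ≤ m) :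
    -- the finite-index subgroups can be enumerated, with all the partial intersections normal
    (∃ N : ℕ → Subgroup (FreeGroup (Fin m)),
      Set.range N = {H : Subgroup (FreeGroup (Fin m)) | H.FiniteIndex} ∧
      ∀ i, (firstInter N i).Normal) ∧
    -- the groups `F_m / M_i''`
    (∀ N : ℕ → Subgroup (FreeGroup (Fin m)),
      (∀ i, (N i).FiniteIndex) →
      (∀ H : Subgroup (FreeGroup (Fin m)), H.Normal → H.FiniteIndex → ∃ i, N i = H) →
      (∀ (i : ℕ) [(firstInter N i).Normal],
        ((firstInter N i).map (QuotientGroup.mk' (secondDerived (firstInter N i)))).Normal ∧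
        ((firstInter N i).map (QuotientGroup.mk' (secondDerived (firstInter N i)))).FiniteIndex ∧
        IsFreeMetabelian
          ((firstInter N i).map (QuotientGroup.mk' (secondDerived (firstInter N i))))) ∧
      ∃ w : ℕ → ℝ,
        (∀ (i : ℕ) [(firstInter N i).Normal],
          HasGrowthRate
            (Set.range fun a : Fin m =>
              QuotientGroup.mk' (secondDerived (firstInter N i)) (FreeGroup.of a))
            (w i)) ∧
        Tendsto w atTop (𝓝 (2 * (m : ℝ) - 1))) ∧
    -- the consequence
    (∀ ε : ℝ, 0 < ε →
      ∃ (G : Type) (_ : Group G) (a : Fin m → G),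
        Subgroup.closure (Set.range a) = ⊤ ∧
        IsAmenableGroup G ∧
        IsMetabelianByFinite G ∧
        ∃ w : ℝ, HasGrowthRate (Set.range a) w ∧ |w - (2 * (m : ℝ) - 1)| < ε) := by
  obtain ⟨N, hN, hnormal⟩ := exists_enumeration_finiteIndex (G := FreeGroup (Fin m))
  have hmem : ∀ i, (N i).FiniteIndex := fun i => by
    have : N i ∈ {H : Subgroup (FreeGroup (Fin m)) | H.FiniteIndex} := hN ▸ Set.mem_range_self i
    exact this
  refine ⟨⟨N, hN, hnormal⟩, fun N' hfin hall => ⟨fun i _ => ?_, exists_growthRates_tendsto hm hall⟩,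
    fun ε hε => ?_⟩
  · have := firstInter_finiteIndex hfin i
    exact ⟨map_mk_normal _, map_mk_finiteIndex _, isFreeMetabelian_map_secondDerived _⟩
  · obtain ⟨w, hw, hlim⟩ := exists_growthRates_tendsto hm (N := N) fun H _ hH => by
      have : H ∈ Set.range N := hN ▸ hH
      exact this
    obtain ⟨i, hi⟩ := (Metric.tendsto_nhds.1 hlim ε hε).exists
    have := hnormal i
    have := firstInter_finiteIndex hmem i
    have hmet := isMetabelianByFinite_quotient (firstInter N i)
    refine ⟨FreeGroup (Fin m) ⧸ secondDerived (firstInter N i), inferInstance, fun a =>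
      QuotientGroup.mk' (secondDerived (firstInter N i)) (FreeGroup.of a), ?_,
      hmet.isAmenableGroup, hmet, w i, hw i, by rwa [Real.dist_eq] at hi⟩
    have h1 := congrArg (Subgroup.map (QuotientGroup.mk' (secondDerived (firstInter N i))))
      (FreeGroup.closure_range_of (Fin m))
    rw [MonoidHom.map_closure, ← Set.range_comp,
      Subgroup.map_top_of_surjective _ (QuotientGroup.mk'_surjective _)] at h1
    exact h1
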